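/- Let $\Sigma$ be a finite alphabet and write $|\Sigma|$ for its number of letters. Let $\mathrm{FO}^2[<]$ be first-order logic on finite words over $\Sigma$ with only two variables $x,y$ (which may be re-quantified), the letter predicates $Q_a$ ($a\in\Sigma$), equality, and the linear order $<$ on the positions $1,\dots,|w|$ of a word $w$. For $n\in\mathbb N$, let $\mathrm{FO}^2_n$ be the set of formulas of quantifier depth at most $n$, and for $m,n\in\mathbb N$ let $\mathrm{FO}^2_{m,n}$ be the set of those formulas in $\mathrm{FO}^2_n$ for which every path in the parse tree has at most $m$ blocks of alternating quantifiers (a quantifier below an odd number of negations being counted as its dual). For words $u,v\in\Sigma^\star$ write $u\equiv^2_n v$ if $u$ and $v$ agree on all formulas in $\mathrm{FO}^2_n$, and $u\equiv^2_{m,n}v$ if they agree on all formulas in $\mathrm{FO}^2_{m,n}$. This can be read in two ways: for sentences only, or for all formulas, where free variables take the first position as their default value (and, in the empty word, no letter predicate holds of a free variable). **Theorem.** Let $n\in\mathbb N$. 1. For all $u,v\in\Sigma^\star$, if $u\equiv^2_{|\Sigma|+1,n}v$ then $u\equiv^2_n v$. This holds under both readings of the two relations (the same reading being used in hypothesis and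 conclusion). 2. Consequently at most $|\Sigma|+1$ alternation blocks are useful in $\mathrm{FO}^2[<]$: for every sentence $\varphi\in\mathrm{FO}^2_n$ there is a sentence $\psi\in\mathrm{FO}^2_{|\Sigma|+1,n}$ such that every word $w\in\Sigma^\star$ satisfies $\varphi$ if and only if it satisfies $\psi$. -/

import Mathlib

/-! First-order logic with two variables on finite words over an alphabet `A`,
with the linear order on positions as the only numerical predicate. -/

namespace FO2

/-- The two variables: `0` stands for `x` and `1` stands for `y`. -/
abbrev Var := Fin 2

/-- Formulas of two-variable first-order logic with order over the alphabet `A`. The quantifiers may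
re-use the two variables. -/
inductive Formula (A : Type*) where
  /-- `letter a z` is the atom `Q_a(z)`. -/
  | letter (a : A) (z : Var)
  /-- `lt z z'` is the atom `z < z'`. -/
  | lt (z z' : Var)
  /-- `eq z z'` is the atom `z = z'`. -/
  | eq (z z' : Var)
  | neg (φ : Formula A)
  | and (φ ψ : Formula A)
  | or (φ ψ : Formula A)
  | ex (z : Var) (φ : Formula A)
  | all (z : Var) (φ : Formula A)

variable {A : Type*}

namespace Formula

/-- Satisfaction of a formula in the word `w`, whose positions are `1, …, |w|`, under the
valuation `s` of the two variables. The letter at position `i` is `w[i - 1]`. -/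
def Sat (w : List A) : (Var → ℕ) → Formula A → Prop
  | s, letter a z => 1 ≤ s z ∧ w[s z - 1]? = some a
  | s, lt z z' => s z < s z'
  | s, eq z z' => s z = s z'
  | s, neg φ => ¬ Sat w s φ
  | s, and φ ψ => Sat w s φ ∧ Sat w s ψ
  | s, or φ ψ => Sat w s φ ∨ Sat w s ψ
  | s, ex z φ => ∃ i : ℕ, 1 ≤ i ∧ i ≤ w.length ∧ Sat w (Function.update s z i) φ
  | s, all z φ => ∀ i : ℕ, 1 ≤ i → i ≤ w.length → Sat w (Function.update s z i) φ

/-- The set of free variables. -/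
def free : Formula A → Finset Var
  | letter _ z => {z}
  | lt z z' => {z, z'}
  | eq z z' => {z, z'}
  | neg φ => free φ
  | and φ ψ => free φ ∪ free ψ
  | or φ ψ => free φ ∪ free ψ
  | ex z φ => (free φ).erase z
  | all z φ => (free φ).erase z

/-- A sentence is a formula without free variables. -/
def IsSentence (φ : Formula A) : Prop := φ.free = ∅

/-- Quantifier depth. -/
def depth : Formula A → ℕ
  | letter _ _ => 0
  | lt _ _ => 0
  | eq _ _ => 0
  | neg φ => depth φ
  | and φ ψ => max (depth φ) (depth ψ)
  | or φ ψ => max (depth φ) (depth ψ)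
  | ex _ φ => depth φ + 1
  | all _ φ => depth φ + 1

/-- `blocksFrom last pos φ` is the maximal number of quantifier blocks that are opened along a path
of the parse tree of `φ`, when `φ` is a subformula that occurs positively (`pos = true`) or
negatively (`pos = false`), and `last` is the kind of the innermost quantifier above it, if any.
Kinds (`true` is existential, `false` is universal) are those of the negation normal form: a
quantifier below an odd number of negations counts as its dual. -/
def blocksFrom : Option Bool → Bool → Formula A → ℕ
  | _, _, letter _ _ => 0
  | _, _, lt _ _ => 0
  | _, _, eq _ _ => 0
  | last, pos, neg φ => blocksFrom last (!pos) φ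
  | last, pos, and φ ψ => max (blocksFrom last pos φ) (blocksFrom last pos ψ)
  | last, pos, or φ ψ => max (blocksFrom last pos φ) (blocksFrom last pos ψ)
  | last, pos, ex _ φ =>
      (if last = some pos then 0 else 1) + blocksFrom (some pos) pos φ
  | last, pos, all _ φ =>
      (if last = some (!pos) then 0 else 1) + blocksFrom (some (!pos)) pos φ

/-- The maximal number of alternating quantifier blocks on a path of the parse tree. -/
def blocks (φ : Formula A) : ℕ := blocksFrom none true φ

/-- The word `w` satisfies `φ`. Variables that are free in `φ` are interpreted by the first
position, which is the default value of both variables. For a sentence this default plays no role;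
in the empty word, where there is no first position, no letter predicate holds of a free variable. -/
def Holds (w : List A) (φ : Formula A) : Prop := Sat w (fun _ => 1) φ

end Formula

/-- The class of formulas with two variables and quantifier depth at most `n`. -/
def FO2Depth (A : Type*) (n : ℕ) : Set (Formula A) := {φ | φ.depth ≤ n}

/-- The class of formulas with two variables, quantifier depth at most `n`, and at most `m`
alternating quantifier blocks on every path of the parse tree. -/
def FO2Alt (A : Type*) (m n : ℕ) : Set (Formula A) := {φ | φ.depth ≤ n ∧ φ.blocks ≤ m}

/-- The words `u` and `v` agree on all formulas of the class `L`. -/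
def AgreeOn (L : Set (Formula A)) (u v : List A) : Prop :=
  ∀ φ ∈ L, (φ.Holds u ↔ φ.Holds v)

/-- The words `u` and `v` agree on all sentences of the class `L`. -/
def AgreeOnSentences (L : Set (Formula A)) (u v : List A) : Prop :=
  AgreeOn {φ ∈ L | φ.IsSentence} u v

end FO2

namespace FO2

open Formula

variable {A : Type*}

/-! ### Positions and directions -/

/-! The proof is an Ehrenfeucht–Fraïssé argument in which positions are compared only with landmarks
(a form of rankers): points reached from the ends of the word by steps to the next occurrence of a
letter, to the right or to the left. With two pebbles, a move can be answered by a position with the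
same letter in the same gap between landmarks of the next lower rank (`Match.respond`). This works
once landmarks can be continued alike in both words (`Landmark.hasNext`) and are ordered alike
(`Landmark.before_iff`).

The bound on blocks comes from confining each step to an interval between earlier landmarks in which
the letters of a set `S` are missing. Going on in the same direction prolongs an existential block.
Turning back costs one alternation, but the walk is then confined between the new landmark and the
previous one, where the letter just sought is missing as well, so `S` grows. A step that leaves its
interval is replaced by one starting at the bounding landmark of lower rank (`Similar.next_toward`).
The letter found is never in `S`, so `|S| + 1 ≤ |A|` blocks define the two sides of a landmark; one
existential quantifier in front of a Boolean combination of these gives `|A| + 1`.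

The statement on sentences follows because sentences of bounded depth define finitely many
languages, and a finite Boolean algebra of sets contains every union of its classes. -/

/-- The letter at position `i` of `w`, if `i` is a position of `w`. -/
def letterAt (w : List A) (i : ℕ) : Option A := if 1 ≤ i then w[i - 1]? else none

theorem letterAt_eq_some {w : List A} {i : ℕ} {a : A} :
    letterAt w i = some a ↔ 1 ≤ i ∧ w[i - 1]? = some a := by
  unfold letterAt
  split_ifs with h <;> simp [h]

theorem range_of_letterAt {w : List A} {i : ℕ} {a : A} (h : letterAt w i = some a) :
    1 ≤ i ∧ i ≤ w.length := by
  obtain ⟨h1, h2⟩ := letterAt_eq_some.1 h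
  obtain ⟨h3, -⟩ := List.getElem?_eq_some_iff.1 h2
  omega

theorem exists_letterAt {w : List A} {i : ℕ} (h1 : 1 ≤ i) (h2 : i ≤ w.length) :
    ∃ a, letterAt w i = some a :=
  ⟨w[i - 1]'(by omega), letterAt_eq_some.2 ⟨h1, List.getElem?_eq_getElem (by omega)⟩⟩

/-- `Before d i j` says that `j` comes strictly after `i` in the reading direction `d`, where `true`
stands for left to right. -/
def Before : Bool → ℕ → ℕ → Prop
  | true, i, j => i < j
  | false, i, j => j < i

@[simp] theorem before_true {i j : ℕ} : Before true i j ↔ i < j := Iff.rfl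

@[simp] theorem before_false {i j : ℕ} : Before false i j ↔ j < i := Iff.rfl

theorem Before.trans {d : Bool} {i j k : ℕ} (h : Before d i j) (h' : Before d j k) :
    Before d i k := by
  cases d <;> simp at * <;> omega

theorem Before.asymm {d : Bool} {i j : ℕ} (h : Before d i j) : ¬ Before d j i := by
  cases d <;> simp at * <;> omega

theorem Before.ne {d : Bool} {i j : ℕ} (h : Before d i j) : i ≠ j := by
  cases d <;> simp at * <;> omega

theorem before_not {d : Bool} {i j : ℕ} : Before (!d) i j ↔ Before d j i := by
  cases d <;> simp

theorem before_trichotomy (d : Bool) (i j : ℕ) : Before d i j ∨ i = j ∨ Before d j i := by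
  cases d <;> simp <;> omega

theorem not_before {d : Bool} {i j : ℕ} : ¬ Before d i j ↔ i = j ∨ Before d j i := by
  cases d <;> simp <;> omega

/-- The boundary position from which `w` is read in direction `d`. -/
def origin (w : List A) : Bool → ℕ
  | true => 0
  | false => w.length + 1

theorem before_origin {w : List A} {i : ℕ} (d : Bool) (h1 : 1 ≤ i) (h2 : i ≤ w.length) :
    Before d (origin w d) i := by
  cases d <;> simp [origin] <;> omega

theorem letterAt_origin (w : List A) (d : Bool) : letterAt w (origin w d) = none := by
  cases d <;> simp [origin, letterAt]

/-- `IsNext d w a i j` says that `j` is the first position with letter `a` that is met after `i`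
when `w` is read in direction `d`. -/
structure IsNext (d : Bool) (w : List A) (a : A) (i j : ℕ) : Prop where
  letter : letterAt w j = some a
  before : Before d i j
  avoids : ∀ t, Before d i t → Before d t j → letterAt w t ≠ some a

theorem exists_minimal_value {α : Type*} {S : α → Prop} (f : α → ℕ) (h : ∃ x, S x) :
    ∃ x, S x ∧ ∀ y, S y → f x ≤ f y := by
  obtain ⟨x, hx, hmin⟩ := (measure f).wf.has_min {x | S x} h
  exact ⟨x, hx, fun y hy => not_lt.1 (hmin y hy)⟩

theorem exists_isNext {d : Bool} {w : List A} {a : A} {i t : ℕ} (ha : letterAt w t = some a)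
    (ht : Before d i t) : ∃ j, IsNext d w a i j ∧ ¬ Before d t j := by
  -- With truncated subtraction the sum is the distance from `i`, whichever direction is read.
  obtain ⟨j, ⟨hj, hij⟩, hmin⟩ := exists_minimal_value
    (S := fun j => letterAt w j = some a ∧ Before d i j) (fun j => (j - i) + (i - j)) ⟨t, ha, ht⟩
  have key : ∀ r, letterAt w r = some a → Before d i r → ¬ Before d r j := by
    intro r hr hir
    have := hmin r ⟨hr, hir⟩
    cases d <;> simp at * <;> omega
  exact ⟨j, ⟨hj, hij, fun r h1 h2 h3 => key r h3 h1 h2⟩, key t ha ht⟩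

/-! ### Alternation blocks -/

/-- Negation dualizes every quantifier, hence preserves alternations. This makes negation free when
no quantifier stands above. -/
theorem Formula.blocksFrom_dual (φ : Formula A) (last : Option Bool) (pos : Bool) :
    φ.blocksFrom (last.map not) (!pos) = φ.blocksFrom last pos := by
  induction φ generalizing last pos with
  | letter | lt | eq => rfl
  | neg φ ih => exact ih last (!pos)
  | and φ ψ ih1 ih2 => simp only [blocksFrom, ih1, ih2]
  | or φ ψ ih1 ih2 => simp only [blocksFrom, ih1, ih2]
  | ex z φ ih =>
    have := ih (some pos) pos
    simp only [Option.map_some] at this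
    simp only [blocksFrom, this]
    rcases last with _ | _ | _ <;> cases pos <;> simp
  | all z φ ih =>
    have := ih (some (!pos)) pos
    simp only [Option.map_some] at this
    simp only [blocksFrom, this]
    rcases last with _ | _ | _ <;> cases pos <;> simp

/-- The context only decides whether the first quantifier on a path opens a block. -/
theorem Formula.blocksFrom_le_succ (φ : Formula A) (last last' : Option Bool) (pos : Bool) :
    φ.blocksFrom last pos ≤ φ.blocksFrom last' pos + 1 := by
  induction φ generalizing pos with
  | letter | lt | eq => simp [blocksFrom]
  | neg φ ih => exact ih (!pos)
  | and φ ψ ih1 ih2 =>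
    have := ih1 pos
    have := ih2 pos
    simp only [blocksFrom]
    omega
  | or φ ψ ih1 ih2 =>
    have := ih1 pos
    have := ih2 pos
    simp only [blocksFrom]
    omega
  | ex z φ | all z φ =>
    simp only [blocksFrom]
    split_ifs <;> omega

theorem Formula.blocksFrom_some_le (φ : Formula A) (b pos : Bool) :
    φ.blocksFrom (some b) pos ≤ φ.blocksFrom none pos := by
  induction φ generalizing pos with
  | letter | lt | eq => simp [blocksFrom]
  | neg φ ih => exact ih (!pos)
  | and φ ψ ih1 ih2 =>
    have := ih1 pos
    have := ih2 pos
    simp only [blocksFrom]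
    omega
  | or φ ψ ih1 ih2 =>
    have := ih1 pos
    have := ih2 pos
    simp only [blocksFrom]
    omega
  | ex z φ | all z φ =>
    simp only [blocksFrom]
    split_ifs <;> simp_all

/-! ### Families of unary predicates that are definable uniformly in two words -/

/-- The predicates `X b` on the positions of the words `w b` are defined, in both words, by one
formula of depth at most `l` that opens at most `m` blocks below a quantifier of kind `last`. -/
def Definable (w : Bool → List A) (last : Option Bool) (m l : ℕ) (X : Bool → ℕ → Prop) : Prop :=
  ∀ z, ∃ φ : Formula A, φ.depth ≤ l ∧ φ.blocksFrom last true ≤ m ∧ φ.free ⊆ {z} ∧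
    ∀ b s, 1 ≤ s z → s z ≤ (w b).length → (φ.Sat (w b) s ↔ X b (s z))

section Definable

variable {w : Bool → List A} {last : Option Bool} {m l : ℕ} {X Y : Bool → ℕ → Prop}

theorem Definable.congr (h : Definable w last m l X)
    (hXY : ∀ b i, 1 ≤ i → i ≤ (w b).length → (X b i ↔ Y b i)) : Definable w last m l Y := by
  intro z
  obtain ⟨φ, h1, h2, h3, h4⟩ := h z
  exact ⟨φ, h1, h2, h3, fun b s hs hs' => (h4 b s hs hs').trans (hXY b _ hs hs')⟩

theorem Definable.mono (h : Definable w last m l X) {m' l' : ℕ} (hm : m ≤ m') (hl : l ≤ l') :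
    Definable w last m' l' X := by
  intro z
  obtain ⟨φ, h1, h2, h3, h4⟩ := h z
  exact ⟨φ, h1.trans hl, h2.trans hm, h3, h4⟩

theorem definable_true : Definable w last m l fun _ _ => True := fun z =>
  ⟨.eq z z, by simp [depth], by simp [blocksFrom], by simp [free], by simp [Sat]⟩

theorem definable_letterAt (a : A) : Definable w last m l fun b i => letterAt (w b) i = some a :=
  fun z => ⟨.letter a z, by simp [depth], by simp [blocksFrom], by simp [free], by
    simp [Sat, letterAt_eq_some]⟩

theorem Definable.and (h : Definable w last m l X) (h' : Definable w last m l Y) :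
    Definable w last m l fun b i => X b i ∧ Y b i := by
  intro z
  obtain ⟨φ, h1, h2, h3, h4⟩ := h z
  obtain ⟨ψ, k1, k2, k3, k4⟩ := h' z
  refine ⟨.and φ ψ, max_le h1 k1, max_le h2 k2, Finset.union_subset h3 k3, ?_⟩
  intro b s hs hs'
  simp only [Sat, h4 b s hs hs', k4 b s hs hs']

theorem Definable.not (h : Definable w none m l X) :
    Definable w none m l fun b i => ¬ X b i := by
  intro z
  obtain ⟨φ, h1, h2, h3, h4⟩ := h z
  refine ⟨.neg φ, h1, (φ.blocksFrom_dual none true).trans_le h2, h3, ?_⟩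
  intro b s hs hs'
  simp only [Sat, h4 b s hs hs']

/-- Below an existential quantifier the dualized formula may no longer merge with the block above;
this is the price of one change of direction. -/
theorem Definable.not_some (h : Definable w (some true) m l X) :
    Definable w (some true) (m + 1) l fun b i => ¬ X b i := by
  intro z
  obtain ⟨φ, h1, h2, h3, h4⟩ := h z
  refine ⟨.neg φ, h1, ?_, h3, ?_⟩
  · have e1 := φ.blocksFrom_dual (some false) true
    have e2 := φ.blocksFrom_le_succ (some false) (some true) true
    simp only [Option.map_some, Bool.not_false] at e1
    simp only [blocksFrom]
    omega
  · intro b s hs hs'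
    simp only [Sat, h4 b s hs hs']

theorem Definable.none_of_some (h : Definable w (some true) m l X) :
    Definable w none (m + 1) l X := by
  intro z
  obtain ⟨φ, h1, h2, h3, h4⟩ := h z
  exact ⟨φ, h1, (φ.blocksFrom_le_succ none (some true) true).trans (by omega), h3, h4⟩

/-- The atom saying that `z` comes before `z'` in direction `d`. -/
def beforeAtom (A : Type*) (d : Bool) (z z' : Var) : Formula A := bif d then .lt z z' else .lt z' z

/-- An existential quantification over the positions before the current one (or not after it, if
`strict` is `false`) opens no new block below an existential quantifier. -/
theorem Definable.exists_before (h : Definable w (some true) m l X) (d strict : Bool) :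
    Definable w (some true) m (l + 1) fun b i =>
      ∃ j, 1 ≤ j ∧ j ≤ (w b).length ∧ (Before d j i ∨ strict = false ∧ j = i) ∧ X b j := by
  intro z
  obtain ⟨z', hz⟩ : ∃ z' : Var, z' ≠ z := exists_ne z
  obtain ⟨φ, h1, h2, h3, h4⟩ := h z'
  let ρ : Formula A := bif strict then beforeAtom A d z' z else .or (beforeAtom A d z' z) (.eq z' z)
  have d1 : ρ.depth = 0 := by cases strict <;> cases d <;> rfl
  have d2 : ρ.blocksFrom (some true) true = 0 := by cases strict <;> cases d <;> rfl
  have d3 : ρ.free ⊆ {z, z'} := by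
    cases strict <;> cases d <;> simp [ρ, beforeAtom, free, Finset.insert_subset_iff]
  have d4 : ∀ (v : List A) s, ρ.Sat v s ↔
      (Before d (s z') (s z) ∨ strict = false ∧ s z' = s z) := by
    intro v s
    cases strict <;> cases d <;> simp [ρ, beforeAtom, Sat]
  refine ⟨.ex z' (.and ρ φ), ?_, ?_, ?_, ?_⟩
  · simp only [depth, d1]; omega
  · simp only [blocksFrom, d2, if_true]; omega
  · intro x hx
    simp only [free, Finset.mem_erase, Finset.mem_union] at hx
    obtain ⟨hne, hx | hx⟩ := hx
    · have := d3 hx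
      simp_all
    · exact absurd (Finset.mem_singleton.1 (h3 hx)) hne
  · intro b s hs hs'
    simp only [Sat, d4]
    refine exists_congr fun i => and_congr_right fun hi => and_congr_right fun hi' => ?_
    have e := h4 b (Function.update s z' i) (by simpa using hi) (by simpa using hi')
    rw [e]
    simp [Function.update_of_ne hz.symm]

/-- The positions after the next letter `a` are definable by one more quantifier. -/
theorem Definable.after_next {d : Bool} {p c : Bool → ℕ} {a : A}
    (h : Definable w (some true) m l fun b i => Before d (p b) i)
    (hc : ∀ b, IsNext d (w b) a (p b) (c b)) (strict : Bool) :
    Definable w (some true) m (l + 1) fun b i => Before d (c b) i ∨ strict = false ∧ c b = i := by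
  refine (((definable_letterAt a).and h).exists_before d strict).congr ?_
  intro b i _ _
  constructor
  · rintro ⟨j, -, -, hji, hj, hpj⟩
    -- The next `a` is the first witness, so any witness `j` can be replaced by `c b`.
    have : ¬ Before d j (c b) := fun hjc => (hc b).avoids j hpj hjc hj
    rcases not_before.1 this with rfl | hcj
    · exact hji
    · rcases hji with hji | ⟨-, rfl⟩
      · exact .inl (hcj.trans hji)
      · exact .inl hcj
  · intro h
    obtain ⟨h1, h2⟩ := range_of_letterAt (hc b).letter
    exact ⟨c b, h1, h2, h, (hc b).letter, (hc b).before⟩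

end Definable

/-! ### Landmarks -/

/-- A landmark of rank at most `l` is a pair of positions, one in each word, that is reached from the
boundaries by at most `l` steps, each to the next letter `a` in some direction `d`. Each step stays
strictly between two earlier landmarks `prev` and `far`, and no letter of `S` occurs between
these. -/
inductive Landmark (w : Bool → List A) : ℕ → (Bool → ℕ) → Prop
  | boundary (l : ℕ) (d : Bool) : Landmark w l fun b => origin (w b) d
  | step {l : ℕ} {d : Bool} {S : Finset A} {a : A} {prev far cur : Bool → ℕ}
      (hprev : Landmark w l prev) (hfar : Landmark w l far)
      (hnext : ∀ b, IsNext d (w b) a (prev b) (cur b))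
      (hcur : ∀ b, Before d (cur b) (far b))
      (hS : ∀ b t, Before d (prev b) t → Before d t (far b) → ∀ x ∈ S, letterAt (w b) t ≠ some x)
      -- The count is taken below an existential quantifier, so on its own the formula may have
      -- `S.card + 1` blocks. The non-strict version is what gets negated when the direction
      -- changes.
      (hdef : ∀ strict, Definable w (some true) S.card (l + 1)
        fun b i => Before d (cur b) i ∨ strict = false ∧ cur b = i) :
      Landmark w (l + 1) cur

section Landmark

variable {w : Bool → List A} {l l' n : ℕ} {p q : Bool → ℕ}

theorem Landmark.succ (h : Landmark w l p) : Landmark w (l + 1) p := by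
  induction h with
  | boundary l d => exact .boundary _ d
  | step _ _ hnext hcur hS hdef ih1 ih2 =>
    exact .step ih1 ih2 hnext hcur hS fun s => (hdef s).mono le_rfl (Nat.le_succ _)

theorem Landmark.mono (h : Landmark w l p) (hl : l ≤ l') : Landmark w l' p := by
  induction hl with
  | refl => exact h
  | step _ ih => exact ih.succ

theorem Landmark.letterAt_eq (h : Landmark w l p) (b b' : Bool) :
    letterAt (w b) (p b) = letterAt (w b') (p b') := by
  cases h with
  | boundary l d => simp only [letterAt_origin]
  | step _ _ hnext => rw [(hnext b).letter, (hnext b').letter]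

/-- The step ends inside the interval that avoids `S`. This is what bounds the number of turns by
the size of the alphabet. -/
theorem notMem_of_isNext {d : Bool} {S : Finset A} {a : A} {prev far cur : Bool → ℕ}
    (hnext : ∀ b, IsNext d (w b) a (prev b) (cur b)) (hcur : ∀ b, Before d (cur b) (far b))
    (hS : ∀ b t, Before d (prev b) t → Before d t (far b) → ∀ x ∈ S, letterAt (w b) t ≠ some x) :
    a ∉ S :=
  fun ha => hS true _ (hnext true).before (hcur true) a ha (hnext true).letter

/-- The set of positions after (or before) a landmark of rank `l` is definable in depth `l` and with
as many blocks as there are letters. -/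
theorem Landmark.definable [Fintype A] (h : Landmark w l p) (e : Bool) :
    Definable w none (Fintype.card A) l fun b i => Before e (p b) i := by
  cases h with
  | boundary l d =>
    rcases eq_or_ne e d with rfl | hed
    · exact definable_true.congr fun b i h1 h2 => by simpa using before_origin e h1 h2
    · obtain rfl : d = !e := by cases d <;> cases e <;> simp_all
      refine definable_true.not.congr fun b i h1 h2 => ?_
      have := (before_not.1 (before_origin (!e) h1 h2)).asymm
      simpa using this
  | @step l d S a prev far _ _ _ hnext hcur hS hdef =>
    have hcard : S.card + 1 ≤ Fintype.card A := by
      rw [← Finset.card_cons (notMem_of_isNext hnext hcur hS)]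
      exact Finset.card_le_univ _
    rcases eq_or_ne e d with rfl | hed
    · exact ((hdef true).none_of_some.mono hcard le_rfl).congr fun b i _ _ => by simp
    · obtain rfl : e = !d := by cases d <;> cases e <;> simp_all
      refine ((hdef false).none_of_some.mono hcard le_rfl).not.congr fun b i _ _ => ?_
      rw [before_not]
      have := before_trichotomy d (p b) i
      constructor
      · rintro h; simp at h; tauto
      · rintro h (h' | ⟨-, h'⟩)
        · exact h.asymm h'
        · exact h.ne h'.symm

/-- The two words satisfy the same existential quantifications of predicates that are definable
with `|A|` blocks and in depth less than `n`. -/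
def Similar [Fintype A] (w : Bool → List A) (n : ℕ) : Prop :=
  ∀ l, l + 1 ≤ n → ∀ X, Definable w none (Fintype.card A) l X → ∀ b b',
    (∃ i, 1 ≤ i ∧ i ≤ (w b).length ∧ X b i) → ∃ i, 1 ≤ i ∧ i ≤ (w b').length ∧ X b' i

theorem Similar.exists_letterAt [Fintype A] (hw : Similar w n) (hl : l + 1 ≤ n)
    {X : Bool → ℕ → Prop}
    (hX : Definable w none (Fintype.card A) l X) {b : Bool} (b' : Bool) {a : A} {i : ℕ}
    (hi : letterAt (w b) i = some a) (hXi : X b i) : ∃ j, letterAt (w b') j = some a ∧ X b' j := by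
  obtain ⟨h1, h2⟩ := range_of_letterAt hi
  obtain ⟨j, -, -, h⟩ := hw l hl _ ((definable_letterAt a).and hX) b b' ⟨i, h1, h2, hi, hXi⟩
  exact ⟨j, h⟩

/-- The next `a` after `p` exists in both words or in none, and is then a landmark of rank
`l + 1`. -/
def HasNext (w : Bool → List A) (l : ℕ) (p : Bool → ℕ) : Prop :=
  ∀ e a b t, letterAt (w b) t = some a → Before e (p b) t →
    ∃ c, Landmark w (l + 1) c ∧ ∀ b, IsNext e (w b) a (p b) (c b)

/-- An `a` between two landmarks is an existential statement about their definable sides, so it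
transfers to the other word; the first such `a` is still before `q`. -/
theorem Similar.exists_isNext_between [Fintype A] (hw : Similar w n) (hl : l + 1 ≤ n)
    (hp : Landmark w l p)
    (hq : Landmark w l q) {e b : Bool} {a : A} {t : ℕ} (ht : letterAt (w b) t = some a)
    (hpt : Before e (p b) t) (htq : Before e t (q b)) :
    ∃ c : Bool → ℕ, (∀ b, IsNext e (w b) a (p b) (c b)) ∧ ∀ b, Before e (c b) (q b) := by
  have key : ∀ b', ∃ c, IsNext e (w b') a (p b') c ∧ Before e c (q b') := by
    intro b'
    obtain ⟨j, hj, hpj, hjq⟩ := hw.exists_letterAt hl ((hp.definable e).and (hq.definable (!e))) b'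
      ht ⟨hpt, before_not.2 htq⟩
    obtain ⟨c, hc, hjc⟩ := exists_isNext hj hpj
    rw [before_not] at hjq
    refine ⟨c, hc, ?_⟩
    rcases not_before.1 hjc with rfl | h
    · exact hjq
    · exact h.trans hjq
  choose c hc hcq using key
  exact ⟨c, hc, hcq⟩

/-- If all steps from `q` are possible, then so are the steps from `p` in the direction of `q`,
provided that those that end before `q` lead to landmarks. -/
theorem Similar.next_toward [Fintype A] (hw : Similar w n) (hl : l + 1 ≤ n) (hp : Landmark w l p)
    (hq : Landmark w l q) (hqn : HasNext w l q) {e : Bool} (hpq : ∀ b, Before e (p b) (q b)) {a : A}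
    (hnew : ∀ c : Bool → ℕ, (∀ b, IsNext e (w b) a (p b) (c b)) → (∀ b, Before e (c b) (q b)) →
      Landmark w (l + 1) c) {b : Bool} {t : ℕ} (ht : letterAt (w b) t = some a)
    (hpt : Before e (p b) t) :
    ∃ c, Landmark w (l + 1) c ∧ ∀ b, IsNext e (w b) a (p b) (c b) := by
  by_cases hex : ∃ b t, letterAt (w b) t = some a ∧ Before e (p b) t ∧ Before e t (q b)
  · obtain ⟨b, t, h1, h2, h3⟩ := hex
    obtain ⟨c, hc, hcq⟩ := hw.exists_isNext_between hl hp hq h1 h2 h3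
    exact ⟨c, hnew c hc hcq, hc⟩
  -- With no `a` strictly between in either word, the next `a` after `p` is `q` itself or the next
  -- `a` after `q`.
  · have hno : ∀ b t, Before e (p b) t → Before e t (q b) → letterAt (w b) t ≠ some a :=
      fun b t h1 h2 h3 => hex ⟨b, t, h3, h1, h2⟩
    by_cases hqa : letterAt (w b) (q b) = some a
    · exact ⟨q, hq.succ, fun b' => ⟨(hq.letterAt_eq b' b).trans hqa, hpq b', hno b'⟩⟩
    · have hqt : Before e (q b) t := by
        rcases before_trichotomy e (q b) t with h | rfl | h
        · exact h
        · exact absurd ht hqa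
        · exact absurd ht (hno b t hpt h)
      obtain ⟨c, hc, hcn⟩ := hqn e a b t ht hqt
      refine ⟨c, hc, fun b' => ⟨(hcn b').letter, (hpq b').trans (hcn b').before, ?_⟩⟩
      intro r h1 h2
      rcases before_trichotomy e (q b') r with h | rfl | h
      · exact (hcn b').avoids r h h2
      · rw [hq.letterAt_eq b' b]; exact hqa
      · exact hno b' r h1 h

/-- Induction along the path: steps ending inside the current interval give new landmarks, all
others are inherited from `far` or `prev`. -/
theorem Landmark.hasNext [Fintype A] (hw : Similar w n) (hp : Landmark w l p) (hl : l + 1 ≤ n) :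
    HasNext w l p := by
  induction hp with
  | boundary l d =>
    intro e a b t ht hpt
    obtain ⟨h1, h2⟩ := range_of_letterAt ht
    rcases eq_or_ne e d with rfl | hed
    · obtain ⟨c, hc, hcq⟩ := hw.exists_isNext_between hl (.boundary l e) (.boundary l (!e)) ht hpt
        (before_not.1 (before_origin (!e) h1 h2))
      refine ⟨c, .step (S := ∅) (.boundary l e) (.boundary l (!e)) hc hcq (by simp) ?_, hc⟩
      refine fun strict => Definable.after_next (definable_true.congr fun b i h1 h2 => ?_) hc strict
      simpa using before_origin e h1 h2
    · obtain rfl : d = !e := by cases d <;> cases e <;> simp_all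
      exact absurd hpt (before_not.1 (before_origin (!e) h1 h2)).asymm
  | @step l d S a prev far cur hprev hfar hnext hcur hS hdef ih1 ih2 =>
    have hlm : Landmark w (l + 1) cur := .step hprev hfar hnext hcur hS hdef
    have lift : ∀ {q}, HasNext w l q → HasNext w (l + 1) q := by
      intro q h e a b t ht hqt
      obtain ⟨c, hc, hcn⟩ := h e a b t ht hqt
      exact ⟨c, hc.succ, hcn⟩
    intro e x b t ht hpt
    rcases eq_or_ne e d with rfl | hed
    -- Same direction: the interval shrinks to the part from `cur` to `far`, with the same missing
    -- letters and no new block.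
    · refine hw.next_toward hl hlm hfar.succ (lift (ih2 (by omega))) hcur ?_ ht hpt
      intro c hc hcq
      refine .step hlm hfar.succ hc hcq (fun b t h1 h2 => hS b t ((hnext b).before.trans h1) h2) ?_
      exact fun strict => Definable.after_next
        ((hdef true).congr fun b i _ _ => by simp) hc strict
    · obtain rfl : e = !d := by cases d <;> cases e <;> simp_all
      -- Turning back: between `cur` and `prev` the letter `a` is missing too, since `cur` is the
      -- first `a` after `prev`. The new element of `S` pays for the negation.
      refine hw.next_toward hl hlm hprev.succ (lift (ih1 (by omega)))
        (fun b => before_not.2 (hnext b).before) ?_ ht hpt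
      intro c hc hcq
      have haS := notMem_of_isNext hnext hcur hS
      refine .step (S := Finset.cons a S haS) hlm hprev.succ hc hcq ?_ ?_
      · intro b t h1 h2 y hy
        rw [before_not] at h1 h2
        rcases Finset.mem_cons.1 hy with rfl | hy
        · exact (hnext b).avoids t h2 h1
        · exact hS b t h2 (h1.trans (hcur b)) y hy
      · rw [Finset.card_cons]
        refine fun strict => Definable.after_next ((hdef false).not_some.congr fun b i _ _ => ?_) hc
          strict
        have := not_before (d := d) (i := cur b) (j := i)
        rw [before_not]
        constructor
        · intro h; simp at h; tauto
        · rintro h (h' | ⟨-, h'⟩)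
          · exact h.asymm h'
          · exact h.ne h'.symm

theorem Landmark.before_boundary (hp : Landmark w l p) (d e b b' : Bool)
    (h : Before e (origin (w b) d) (p b)) : Before e (origin (w b') d) (p b') := by
  cases hp with
  | boundary l d' => cases d <;> cases d' <;> cases e <;> simp_all [origin]
  | step _ _ hnext =>
    obtain ⟨h1, h2⟩ := range_of_letterAt (hnext b).letter
    obtain ⟨h3, h4⟩ := range_of_letterAt (hnext b').letter
    cases d <;> cases e <;> simp_all [origin] <;> omega

/-- The order of a landmark of rank `n` and one of rank less than `n` is the same in both words. -/
theorem Landmark.before_iff [Fintype A] (hw : Similar w n) (hp : Landmark w n p)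
    (hq : Landmark w l q)
    (hl : l + 1 ≤ n) (e b b' : Bool) : Before e (p b) (q b) ↔ Before e (p b') (q b') := by
  cases hp with
  | boundary l d => exact ⟨hq.before_boundary d e b b', hq.before_boundary d e b' b⟩
  | @step m d S a prev far _ hprev hfar hnext hcur hS hdef =>
    have hq' : Landmark w m q := hq.mono (by omega)
    -- As `p` is the first `a` after `prev`, it lies before `q` exactly when some `a` after `prev`
    -- does.
    have lt : ∀ b b', Before d (p b) (q b) → Before d (p b') (q b') := by
      intro b b' h
      obtain ⟨j, hj, h1, h2⟩ := hw.exists_letterAt le_rfl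
        ((hprev.definable d).and (hq'.definable (!d))) b' (hnext b).letter
        ⟨(hnext b).before, before_not.2 h⟩
      rw [before_not] at h2
      have := fun h => (hnext b').avoids j h1 h hj
      rcases not_before.1 this with rfl | h3
      exacts [h2, h3.trans h2]
    have le : ∀ b b', ¬ Before d (q b) (p b) → ¬ Before d (q b') (p b') := by
      intro b b' h
      obtain ⟨j, hj, h1, h2⟩ := hw.exists_letterAt le_rfl
        ((hprev.definable d).and (hq'.definable d).not) b' (hnext b).letter
        ⟨(hnext b).before, h⟩
      have := fun h => (hnext b').avoids j h1 h hj
      rcases not_before.1 this with rfl | h3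
      exacts [h2, fun h4 => h2 (h4.trans h3)]
    rcases eq_or_ne e d with rfl | hed
    · exact ⟨lt b b', lt b' b⟩
    · obtain rfl : e = !d := by cases d <;> cases e <;> simp_all
      simp only [before_not]
      exact not_iff_not.1 ⟨le b b', le b' b⟩

/-! ### The game -/

/-- Position `i` of `w b` and position `j` of `w b'` have the same letter and the same order
relative to all landmarks of rank `l`. -/
def Match (w : Bool → List A) (l : ℕ) (b b' : Bool) (i j : ℕ) : Prop :=
  letterAt (w b) i = letterAt (w b') j ∧
    ∀ p, Landmark w l p → ∀ e, Before e i (p b) ↔ Before e j (p b')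

theorem Match.symm {b b' : Bool} {i j : ℕ} (h : Match w l b b' i j) : Match w l b' b j i :=
  ⟨h.1.symm, fun p hp e => (h.2 p hp e).symm⟩

theorem Match.mono {b b' : Bool} {i j : ℕ} (h : Match w l b b' i j) (hl : l' ≤ l) :
    Match w l' b b' i j :=
  ⟨h.1, fun p hp e => h.2 p (hp.mono hl) e⟩

/-- Position 0 is the left boundary; it stands in for a pebble that is not yet placed. -/
theorem match_zero (b b' : Bool) : Match w l b b' 0 0 :=
  ⟨rfl, fun _ hp e => ⟨hp.before_boundary true e b b', hp.before_boundary true e b' b⟩⟩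

/-- The answer is the landmark corresponding to `i'` if there is one. Otherwise it is an `a` in the
same gap between rank-`l` landmarks, taken as a landmark of rank `l + 1` so that its order relative
to `j` is controlled. -/
theorem Match.respond_before [Fintype A] (hw : Similar w n) (hl : l + 1 ≤ n)
    {b b' : Bool} {i j i' : ℕ}
    (h : Match w (l + 1) b b' i j) {a : A} (ha : letterAt (w b) i' = some a) {d : Bool}
    (hd : Before d i i') :
    ∃ j', letterAt (w b') j' = some a ∧ Match w l b b' i' j' ∧ Before d j j' := by
  have hord : ∀ {p q}, Landmark w (l + 1) p → Landmark w l q → ∀ e b b',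
      Before e (p b) (q b) → Before e (p b') (q b') := fun hp hq e b b' =>
    (Landmark.before_iff hw (hp.mono hl) hq hl e b b').1
  by_cases hex : ∃ q, Landmark w l q ∧ q b = i'
  · obtain ⟨q, hq, rfl⟩ := hex
    have e := hq.letterAt_eq b b'
    exact ⟨q b', e.symm.trans ha, ⟨e, fun p hp e' =>
      ⟨hord hq.succ hp e' b b', hord hq.succ hp e' b' b⟩⟩, (h.2 q hq.succ d).1 hd⟩
  · obtain ⟨hi1, hi2⟩ := range_of_letterAt ha
    have near : ∀ e, ∃ r, Landmark w l r ∧ Before e (r b) i' ∧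
        ∀ q, Landmark w l q → Before e (q b) i' → ¬ Before e (r b) (q b) := by
      intro e
      obtain ⟨r, ⟨h1, h2⟩, hmin⟩ := exists_minimal_value
        (S := fun q : Bool → ℕ => Landmark w l q ∧ Before e (q b) i')
        (fun q => (i' - q b) + (q b - i')) ⟨_, .boundary l e, before_origin e hi1 hi2⟩
      refine ⟨r, h1, h2, fun q hq hqi hrq => ?_⟩
      have := hmin q ⟨hq, hqi⟩
      cases e <;> simp at * <;> omega
    obtain ⟨r, hr, hri, hrmax⟩ := near d
    obtain ⟨r', hr', hri', hrmin⟩ := near (!d)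
    simp only [before_not] at hri' hrmin
    suffices H : ∃ c, Landmark w (l + 1) c ∧ letterAt (w b') (c b') = some a ∧
        Before d (r b') (c b') ∧ Before d (c b') (r' b') ∧ Before d j (c b') by
      obtain ⟨c, hc, hca, hrc, hcr, hjc⟩ := H
      refine ⟨c b', hca, ⟨ha.trans hca.symm, fun q hq e => ?_⟩, hjc⟩
      have hqi : q b ≠ i' := fun h => hex ⟨q, hq, h⟩
      -- No landmark of rank `l` lies inside the gap, so `q` is at or before `r`, or at or after
      -- `r'`, in both words.
      have key : (Before d i' (q b) ∧ Before d (c b') (q b')) ∨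
          (Before d (q b) i' ∧ Before d (q b') (c b')) := by
        rcases before_trichotomy d (q b) i' with h1 | h1 | h1
        · have h2 := mt (hord hr.succ hq d b' b) (hrmax q hq h1)
          refine .inr ⟨h1, ?_⟩
          rcases not_before.1 h2 with h3 | h3
          · rwa [← h3]
          · exact h3.trans hrc
        · exact absurd h1 hqi
        · have h2 := mt (hord hq.succ hr' d b' b) (hrmin q hq h1)
          refine .inl ⟨h1, ?_⟩
          rcases not_before.1 h2 with h3 | h3
          · rwa [h3]
          · exact hcr.trans h3
      rcases key with ⟨k1, k2⟩ | ⟨k1, k2⟩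
      · rcases eq_or_ne e d with rfl | hed
        · exact iff_of_true k1 k2
        · obtain rfl : e = !d := by cases d <;> cases e <;> simp_all
          rw [before_not, before_not]
          exact iff_of_false k1.asymm k2.asymm
      · rcases eq_or_ne e d with rfl | hed
        · exact iff_of_false k1.asymm k2.asymm
        · obtain rfl : e = !d := by cases d <;> cases e <;> simp_all
          rw [before_not, before_not]
          exact iff_of_true k1 k2
    by_cases hir : Before d (r b) i
    -- Here `i` lies in the gap, so the search runs backwards from `r'`: the `a` met first is not
    -- before `i'`, hence after `i`, and the rank `l + 1` match puts it after `j`.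
    · obtain ⟨c, hc, hcn⟩ := hr'.hasNext hw hl (!d) a b i' ha (before_not.2 hri')
      have hjc : Before d j (c b') := by
        refine (h.2 c hc d).1 ?_
        have := fun h => (hcn b).avoids i' (before_not.2 hri') h ha
        rw [before_not] at this
        rcases not_before.1 this with h1 | h1
        · rwa [h1]
        · exact hd.trans h1
      have hrj : Before d (r b') j := by
        rw [← before_not]
        exact (h.2 r hr.succ (!d)).1 (before_not.2 hir)
      exact ⟨c, hc, (hcn b').letter, hrj.trans hjc, before_not.1 (hcn b').before, hjc⟩
    -- Here `i` is not beyond `r`, so anything after `r` is after `j`; the first `a` after `r` comes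
    -- no later than `i'`, hence before `r'`.
    · obtain ⟨c, hc, hcn⟩ := hr.hasNext hw hl d a b i' ha hri
      have hcr : Before d (c b') (r' b') := by
        refine hord hc hr' d b b' ?_
        have := fun h => (hcn b).avoids i' hri h ha
        rcases not_before.1 this with h1 | h1
        · rwa [← h1]
        · exact h1.trans hri'
      refine ⟨c, hc, (hcn b').letter, (hcn b').before, hcr, ?_⟩
      have : ¬ Before d (r b') j := by
        rw [← before_not]
        rw [← before_not] at hir
        exact mt (h.2 r hr.succ (!d)).2 hir
      rcases not_before.1 this with h1 | h1
      · rw [← h1]; exact (hcn b').before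
      · exact h1.trans (hcn b').before

theorem Match.respond [Fintype A] (hw : Similar w n) (hl : l + 1 ≤ n) {b b' : Bool} {i j i' : ℕ}
    (h : Match w (l + 1) b b' i j) {a : A} (ha : letterAt (w b) i' = some a) :
    ∃ j', letterAt (w b') j' = some a ∧ Match w l b b' i' j' ∧
      ∀ d, Before d i i' ↔ Before d j j' := by
  have key : ∀ {d}, Before d i i' → ∃ j', letterAt (w b') j' = some a ∧ Match w l b b' i' j' ∧
      ∀ d, Before d i i' ↔ Before d j j' := by
    intro d hd
    obtain ⟨j', h1, h2, h3⟩ := h.respond_before hw hl ha hd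
    refine ⟨j', h1, h2, fun e => ?_⟩
    cases d <;> cases e <;> simp at * <;> omega
  rcases before_trichotomy true i i' with hd | rfl | hd
  · exact key hd
  · exact ⟨j, h.1.symm.trans ha, h.mono (Nat.le_succ l), fun e => by cases e <;> simp⟩
  · exact key (d := false) hd

/-- There are only two variables. -/
theorem Var.eq_of_ne : ∀ {x y z : Var}, x ≠ z → y ≠ z → x = y := by decide

/-- The valuations `s` and `t` match on the variables in `F`. -/
def MatchOn (w : Bool → List A) (l : ℕ) (b b' : Bool) (F : Finset Var) (s t : Var → ℕ) : Prop :=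
  (∀ z ∈ F, Match w l b b' (s z) (t z)) ∧ ∀ z ∈ F, ∀ z' ∈ F, s z < s z' ↔ t z < t z'

theorem MatchOn.symm {b b' : Bool} {F : Finset Var} {s t : Var → ℕ}
    (h : MatchOn w l b b' F s t) : MatchOn w l b' b F t s :=
  ⟨fun z hz => (h.1 z hz).symm, fun z hz z' hz' => (h.2 z hz z' hz').symm⟩

theorem MatchOn.mono {b b' : Bool} {F F' : Finset Var} {s t : Var → ℕ}
    (h : MatchOn w l b b' F s t) (hl : l' ≤ l) (hF : F' ⊆ F) : MatchOn w l' b b' F' s t :=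
  ⟨fun z hz => (h.1 z (hF hz)).mono hl, fun z hz z' hz' => h.2 z (hF hz) z' (hF hz')⟩

theorem MatchOn.respond [Fintype A] (hw : Similar w n) (hl : l + 1 ≤ n)
    {b b' : Bool} {F : Finset Var}
    {s t : Var → ℕ} {z : Var} (h : MatchOn w (l + 1) b b' (F.erase z) s t) {i : ℕ}
    (h1 : 1 ≤ i) (h2 : i ≤ (w b).length) :
    ∃ j, 1 ≤ j ∧ j ≤ (w b').length ∧
      MatchOn w l b b' F (Function.update s z i) (Function.update t z j) := by
  obtain ⟨a, ha⟩ := FO2.exists_letterAt h1 h2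
  -- These are the positions of the other variable, or the left boundary if that variable is not
  -- free.
  obtain ⟨i₀, j₀, hm, hF⟩ : ∃ i₀ j₀, Match w (l + 1) b b' i₀ j₀ ∧
      ∀ x ∈ F, x ≠ z → s x = i₀ ∧ t x = j₀ := by
    by_cases hx : ∃ x ∈ F, x ≠ z
    · obtain ⟨x, hx, hxz⟩ := hx
      refine ⟨s x, t x, h.1 x (Finset.mem_erase.2 ⟨hxz, hx⟩), fun y _ hyz => ?_⟩
      obtain rfl : x = y := Var.eq_of_ne hxz hyz
      exact ⟨rfl, rfl⟩
    · exact ⟨0, 0, match_zero b b', fun x hx' hxz => absurd ⟨x, hx', hxz⟩ hx⟩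
  obtain ⟨j, hj, hij, hord⟩ := hm.respond hw hl ha
  obtain ⟨hj1, hj2⟩ := range_of_letterAt hj
  have o1 := hord true
  have o2 := hord false
  rw [before_true, before_true] at o1
  rw [before_false, before_false] at o2
  refine ⟨j, hj1, hj2, ?_, ?_⟩
  · intro x hx
    rcases eq_or_ne x z with rfl | hxz
    · simpa using hij
    · rw [Function.update_of_ne hxz, Function.update_of_ne hxz]
      exact (h.1 x (Finset.mem_erase.2 ⟨hxz, hx⟩)).mono (Nat.le_succ l)
  · intro x hx y hy
    rcases eq_or_ne x z with rfl | hxz <;> rcases eq_or_ne y x with rfl | hyz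
    · simp
    · obtain ⟨e1, e2⟩ := hF y hy hyz
      simpa [Function.update_of_ne hyz, e1, e2] using o2
    · simp
    · obtain rfl : y = z := by_contra fun h => hxz (Var.eq_of_ne hyz.symm (Ne.symm h))
      obtain ⟨e1, e2⟩ := hF x hx hxz
      simpa [Function.update_of_ne hxz, e1, e2] using o1

/-- Only free variables need to match, so a sentence starts from an empty condition; each quantifier
is one round and lowers the rank by one. -/
theorem MatchOn.sat_iff [Fintype A] (hw : Similar w n) (φ : Formula A) (hl : l ≤ n)
    (hφ : φ.depth ≤ l)
    {b b' : Bool} {s t : Var → ℕ} (h : MatchOn w l b b' φ.free s t) :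
    φ.Sat (w b) s ↔ φ.Sat (w b') t := by
  induction φ generalizing l b b' s t with
  | letter a z =>
    have := (h.1 z (by simp [free])).1
    simp only [Sat, ← letterAt_eq_some, this]
  | lt z z' => exact h.2 z (by simp [free]) z' (by simp [free])
  | eq z z' =>
    have h1 := h.2 z (by simp [free]) z' (by simp [free])
    have h2 := h.2 z' (by simp [free]) z (by simp [free])
    simp only [Sat]
    omega
  | neg φ ih => exact not_congr (ih hl hφ h)
  | and φ ψ ih1 ih2 =>
    obtain ⟨h1, h2⟩ := max_le_iff.1 hφ
    exact and_congr (ih1 hl h1 (h.mono le_rfl Finset.subset_union_left))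
      (ih2 hl h2 (h.mono le_rfl Finset.subset_union_right))
  | or φ ψ ih1 ih2 =>
    obtain ⟨h1, h2⟩ := max_le_iff.1 hφ
    exact or_congr (ih1 hl h1 (h.mono le_rfl Finset.subset_union_left))
      (ih2 hl h2 (h.mono le_rfl Finset.subset_union_right))
  | ex z φ ih =>
    obtain ⟨l, rfl⟩ : ∃ k, l = k + 1 := Nat.exists_eq_add_one.2 (by simp only [depth] at hφ; omega)
    have key : ∀ {b b' s t}, MatchOn w (l + 1) b b' (φ.free.erase z) s t →
        (ex z φ).Sat (w b) s → (ex z φ).Sat (w b') t := by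
      rintro b b' s t h ⟨i, h1, h2, hi⟩
      obtain ⟨j, h3, h4, hj⟩ := h.respond hw hl h1 h2
      exact ⟨j, h3, h4, (ih (by omega) (by simpa [depth] using hφ) hj).1 hi⟩
    exact ⟨key h, key h.symm⟩
  | all z φ ih =>
    obtain ⟨l, rfl⟩ : ∃ k, l = k + 1 := Nat.exists_eq_add_one.2 (by simp only [depth] at hφ; omega)
    have key : ∀ {b b' s t}, MatchOn w (l + 1) b b' (φ.free.erase z) s t →
        (all z φ).Sat (w b) s → (all z φ).Sat (w b') t := by
      intro b b' s t h hall i h1 h2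
      obtain ⟨j, h3, h4, hj⟩ := h.symm.respond hw hl h1 h2
      exact (ih (by omega) (by simpa [depth] using hφ) hj).2 (hall j h3 h4)
    exact ⟨key h, key h.symm⟩

end Landmark

/-! ### Agreement of two words -/

theorem AgreeOnSentences.similar [Fintype A] {n : ℕ} {w : Bool → List A}
    (h : AgreeOnSentences (FO2Alt A (Fintype.card A + 1) n) (w true) (w false)) :
    Similar w n := by
  intro l hl X hX b b'
  obtain ⟨φ, h1, h2, h3, h4⟩ := hX 0
  have hφ : ∀ b, (ex 0 φ).Holds (w b) ↔ ∃ i, 1 ≤ i ∧ i ≤ (w b).length ∧ X b i := by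
    intro b
    simp only [Holds, Sat]
    refine exists_congr fun i => and_congr_right fun hi => and_congr_right fun hi' => ?_
    rw [h4 b _ (by simpa using hi) (by simpa using hi'), Function.update_self]
  have hfree : (ex 0 φ).IsSentence := by
    have : φ.free.erase 0 ⊆ ∅ := by simpa using Finset.erase_subset_erase 0 h3
    exact Finset.subset_empty.1 this
  have hmem : ex 0 φ ∈ FO2Alt A (Fintype.card A + 1) n := by
    have := φ.blocksFrom_some_le true true
    refine ⟨by simp only [depth]; omega, ?_⟩
    simp [blocks, blocksFrom]
    omega
  have := h _ ⟨hmem, hfree⟩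
  rw [← hφ, ← hφ]
  cases b <;> cases b' <;> simp [this]

theorem AgreeOnSentences.depth [Fintype A] {n : ℕ} {u v : List A}
    (h : AgreeOnSentences (FO2Alt A (Fintype.card A + 1) n) u v) :
    AgreeOnSentences (FO2Depth A n) u v := by
  rintro φ ⟨hφ, hfree⟩
  have hw : Similar (fun b => bif b then u else v) n := AgreeOnSentences.similar h
  refine MatchOn.sat_iff hw φ (b := true) (b' := false) le_rfl hφ ?_
  rw [show φ.free = ∅ from hfree]
  simp [MatchOn]

/-- For formulas with free variables, the default positions must also match; the sides of landmarks
are definable within the allowed class, so agreement supplies this. -/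
theorem AgreeOn.depth [Fintype A] {n : ℕ} {u v : List A}
    (h : AgreeOn (FO2Alt A (Fintype.card A + 1) n) u v) : AgreeOn (FO2Depth A n) u v := by
  intro φ hφ
  have hw : Similar (fun b => bif b then u else v) n :=
    AgreeOnSentences.similar (w := fun b => bif b then u else v) fun φ hφ => h φ hφ.1
  have hletter : ∀ a, letterAt u 1 = some a ↔ letterAt v 1 = some a := by
    intro a
    have := h (.letter a 0) ⟨by simp [Formula.depth], by simp [blocks, blocksFrom]⟩
    simpa [Holds, Sat, letterAt_eq_some] using this
  refine MatchOn.sat_iff hw φ (b := true) (b' := false) le_rfl hφ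
    ⟨fun z _ => ⟨Option.ext fun a => by simpa using hletter a, ?_⟩, fun _ _ _ _ => Iff.rfl⟩
  intro p hp e
  by_cases hu : 1 ≤ u.length
  · obtain ⟨a, ha⟩ := exists_letterAt le_rfl hu
    obtain ⟨-, hv⟩ := range_of_letterAt ((hletter a).1 ha)
    obtain ⟨ψ, h1, h2, -, h4⟩ := hp.definable (!e) 0
    have := h ψ ⟨h1, h2.trans (Nat.le_succ _)⟩
    have e1 := h4 true (fun _ => 1) le_rfl hu
    have e2 := h4 false (fun _ => 1) le_rfl hv
    simp only [before_not] at e1 e2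
    exact e1.symm.trans (this.trans e2)
  -- Position 1 is then not a position of the word: both words are empty and the boundaries are the
  -- only landmarks.
  · have hv : ¬ 1 ≤ v.length := by
      intro hv
      obtain ⟨a, ha⟩ := exists_letterAt le_rfl hv
      exact hu (range_of_letterAt ((hletter a).2 ha)).2
    obtain rfl : u = [] := List.eq_nil_of_length_eq_zero (by omega)
    obtain rfl : v = [] := List.eq_nil_of_length_eq_zero (by omega)
    cases hp with
    | boundary l d => cases d <;> rfl
    | step _ _ hnext =>
      obtain ⟨h1, h2⟩ := range_of_letterAt (hnext true).letter
      simp at h2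
      omega

/-! ### Finiteness and definability of unions of classes -/

/-- The formulas of depth at most `n` see a word with a valuation only through a finite type. -/
theorem exists_finite_type.{u} {A : Type u} [Finite A] (n : ℕ) :
    ∃ (T : Type u) (_ : Finite T) (τ : List A → (Var → ℕ) → T), ∀ φ : Formula A, φ.depth ≤ n →
      ∃ P : T → Prop, ∀ w s, φ.Sat w s ↔ P (τ w s) := by
  induction n with
  | zero =>
    refine ⟨(A → Var → Prop) × (Var → Var → Prop), inferInstance,
      fun w s => (fun a z => letterAt w (s z) = some a, fun z z' => s z < s z'), fun φ hφ => ?_⟩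
    induction φ with
    | letter a z => exact ⟨fun x => x.1 a z, fun w s => by simp only [Sat, letterAt_eq_some]⟩
    | lt z z' => exact ⟨fun x => x.2 z z', fun w s => Iff.rfl⟩
    | eq z z' =>
      exact ⟨fun x => ¬ x.2 z z' ∧ ¬ x.2 z' z, fun w s => by simp only [Sat]; omega⟩
    | neg φ ih =>
      obtain ⟨P, hP⟩ := ih hφ
      exact ⟨fun x => ¬ P x, fun w s => not_congr (hP w s)⟩
    | and φ ψ ih1 ih2 =>
      obtain ⟨P, hP⟩ := ih1 (max_le_iff.1 hφ).1
      obtain ⟨Q, hQ⟩ := ih2 (max_le_iff.1 hφ).2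
      exact ⟨fun x => P x ∧ Q x, fun w s => and_congr (hP w s) (hQ w s)⟩
    | or φ ψ ih1 ih2 =>
      obtain ⟨P, hP⟩ := ih1 (max_le_iff.1 hφ).1
      obtain ⟨Q, hQ⟩ := ih2 (max_le_iff.1 hφ).2
      exact ⟨fun x => P x ∨ Q x, fun w s => or_congr (hP w s) (hQ w s)⟩
    | ex z φ | all z φ => simp [Formula.depth] at hφ
  | succ n ih =>
    obtain ⟨T, hT, τ, hτ⟩ := ih
    -- The next type records the old one and, for each variable, the old types reachable by moving
    -- it.
    refine ⟨T × (Var → Set T), inferInstance, fun w s => (τ w s, fun z =>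
      {x | ∃ i, 1 ≤ i ∧ i ≤ w.length ∧ τ w (Function.update s z i) = x}), fun φ hφ => ?_⟩
    induction φ with
    | letter a z =>
      obtain ⟨P, hP⟩ := hτ (.letter a z) (Nat.zero_le _)
      exact ⟨fun x => P x.1, hP⟩
    | lt z z' =>
      obtain ⟨P, hP⟩ := hτ (.lt z z') (Nat.zero_le _)
      exact ⟨fun x => P x.1, hP⟩
    | eq z z' =>
      obtain ⟨P, hP⟩ := hτ (.eq z z') (Nat.zero_le _)
      exact ⟨fun x => P x.1, hP⟩
    | neg φ ih =>
      obtain ⟨P, hP⟩ := ih hφ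
      exact ⟨fun x => ¬ P x, fun w s => not_congr (hP w s)⟩
    | and φ ψ ih1 ih2 =>
      obtain ⟨P, hP⟩ := ih1 (max_le_iff.1 hφ).1
      obtain ⟨Q, hQ⟩ := ih2 (max_le_iff.1 hφ).2
      exact ⟨fun x => P x ∧ Q x, fun w s => and_congr (hP w s) (hQ w s)⟩
    | or φ ψ ih1 ih2 =>
      obtain ⟨P, hP⟩ := ih1 (max_le_iff.1 hφ).1
      obtain ⟨Q, hQ⟩ := ih2 (max_le_iff.1 hφ).2
      exact ⟨fun x => P x ∨ Q x, fun w s => or_congr (hP w s) (hQ w s)⟩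
    | ex z φ =>
      obtain ⟨P, hP⟩ := hτ φ (by simpa [Formula.depth] using hφ)
      exact ⟨fun x => ∃ y ∈ x.2 z, P y, fun w s => by simp [Sat, hP, and_assoc]⟩
    | all z φ =>
      obtain ⟨P, hP⟩ := hτ φ (by simpa [Formula.depth] using hφ)
      refine ⟨fun x => ∀ y ∈ x.2 z, P y, fun w s => ?_⟩
      simp only [Sat, hP, Set.mem_ofPred_eq]
      constructor
      · rintro h _ ⟨i, h1, h2, rfl⟩
        exact h i h1 h2
      · exact fun h i h1 h2 => h _ ⟨i, h1, h2, rfl⟩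

/-- In a finite field of sets, every set that does not separate points agreeing on the field is a
member. -/
theorem mem_of_finite_field_of_sets {α : Type*} {C : Set (Set α)} (hfin : C.Finite)
    (huniv : Set.univ ∈ C) (hcompl : ∀ s ∈ C, sᶜ ∈ C) (hinter : ∀ s ∈ C, ∀ t ∈ C, s ∩ t ∈ C)
    {X : Set α} (hX : ∀ x ∈ X, ∀ y, (∀ s ∈ C, x ∈ s ↔ y ∈ s) → y ∈ X) : X ∈ C := by
  have hsInter : ∀ D ⊆ C, ⋂₀ D ∈ C := by
    intro D hD
    induction D, hfin.subset hD using Set.Finite.induction_on with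
    | empty => simpa using huniv
    | insert _ _ ih =>
      rw [Set.sInter_insert]
      exact hinter _ (hD (Set.mem_insert _ _)) _ (ih ((Set.subset_insert _ _).trans hD))
  have hcls : ∀ x, ⋂₀ {s ∈ C | x ∈ s} ∈ C := fun x => hsInter _ (Set.sep_subset _ _)
  -- The complement of the atom of a point `y` of `X` is a member of `C` that contains `Xᶜ` and
  -- misses `y`.
  have hXc : Xᶜ = ⋂₀ {s ∈ C | Xᶜ ⊆ s} := by
    refine Set.Subset.antisymm (Set.subset_sInter fun s hs => hs.2) fun y hy hyX => ?_
    refine hy (⋂₀ {s ∈ C | y ∈ s})ᶜ ⟨hcompl _ (hcls y), fun z hz hzy => hz ?_⟩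
      (Set.mem_sInter.2 fun s hs => hs.2)
    refine hX y hyX z fun s hs => ⟨fun h => hzy s ⟨hs, h⟩, fun h => ?_⟩
    by_contra hys
    exact hzy sᶜ ⟨hcompl s hs, hys⟩ h
  rw [← compl_compl X]
  refine hcompl _ ?_
  rw [hXc]
  exact hsInter _ (Set.sep_subset _ _)

/-- No atom is closed, so depth 0 has no sentences at all; this excludes `n = 0`, where even truth
would not be expressible. -/
theorem Formula.IsSentence.depth_pos {φ : Formula A} (h : φ.IsSentence) : 1 ≤ φ.depth := by
  induction φ with
  | letter | lt | eq => simp [IsSentence, free] at h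
  | neg φ ih => exact ih h
  | and φ ψ ih | or φ ψ ih =>
    exact (ih (Finset.union_eq_empty.1 h).1).trans (le_max_left _ _)
  | ex | all => simp [Formula.depth]

theorem exists_sentence_of_saturated [Finite A] {m n : ℕ} (hm : 1 ≤ m) (hn : 1 ≤ n)
    {X : Set (List A)}
    (hX : ∀ u ∈ X, ∀ v, AgreeOnSentences (FO2Alt A m n) u v → v ∈ X) :
    ∃ ψ ∈ FO2Alt A m n, ψ.IsSentence ∧ ∀ w, w ∈ X ↔ ψ.Holds w := by
  let C : Set (Set (List A)) := {s | ∃ ψ ∈ FO2Alt A m n, ψ.IsSentence ∧ s = {w | ψ.Holds w}}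
  suffices H : X ∈ C by
    obtain ⟨ψ, h1, h2, rfl⟩ := H
    exact ⟨ψ, h1, h2, fun w => Iff.rfl⟩
  refine mem_of_finite_field_of_sets ?_ ?_ ?_ ?_ ?_
  · obtain ⟨T, hT, τ, hτ⟩ := exists_finite_type (A := A) n
    refine (Set.finite_range fun P : T → Prop => {w : List A | P (τ w fun _ => 1)}).subset ?_
    rintro _ ⟨ψ, h1, -, rfl⟩
    obtain ⟨P, hP⟩ := hτ ψ h1.1
    exact ⟨P, Set.ext fun w => (hP w _).symm⟩
  · refine ⟨.all 0 (.eq 0 0), ⟨by simpa [Formula.depth] using hn, ?_⟩, by simp [IsSentence, free], ?_⟩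
    · simpa [blocks, blocksFrom] using hm
    · simp [Holds, Sat]
  · rintro _ ⟨ψ, h1, h2, rfl⟩
    exact ⟨.neg ψ, ⟨h1.1, (ψ.blocksFrom_dual none true).trans_le h1.2⟩, h2, rfl⟩
  · rintro _ ⟨ψ, h1, h2, rfl⟩ _ ⟨χ, h3, h4, rfl⟩
    exact ⟨.and ψ χ, ⟨max_le h1.1 h3.1, max_le h1.2 h3.2⟩, Finset.union_eq_empty.2 ⟨h2, h4⟩, rfl⟩
  · exact fun u hu v huv => hX u hu v fun ψ hψ => huv _ ⟨ψ, hψ.1, hψ.2, rfl⟩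

end FO2

theorem mainTheorem4 {A : Type*} [Fintype A] (n : ℕ) :
    (∀ u v : List A,
      FO2.AgreeOnSentences (FO2.FO2Alt A (Fintype.card A + 1) n) u v →
        FO2.AgreeOnSentences (FO2.FO2Depth A n) u v) ∧
    (∀ u v : List A,
      FO2.AgreeOn (FO2.FO2Alt A (Fintype.card A + 1) n) u v →
        FO2.AgreeOn (FO2.FO2Depth A n) u v) ∧
    (∀ φ ∈ FO2.FO2Depth A n, φ.IsSentence →
      ∃ ψ ∈ FO2.FO2Alt A (Fintype.card A + 1) n, ψ.IsSentence ∧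
        ∀ w : List A, φ.Holds w ↔ ψ.Holds w) := by
  refine ⟨fun u v h => h.depth, fun u v h => h.depth, fun φ hφ hs => ?_⟩
  exact FO2.exists_sentence_of_saturated (X := {w | φ.Holds w}) (Nat.le_add_left _ _)
    (hs.depth_pos.trans hφ) fun u hu v huv => (huv.depth φ ⟨hφ, hs⟩).1 hu
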